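/- Let $\mathcal{A}$ be a skeletally small abelian length category, i.e. an abelian category in which every object has a composition series; all subcategories are full and closed under isomorphisms. A torsion class is a non-empty subcategory closed under quotients and extensions; $\mathsf{tors}\,\mathcal{A}$ is the complete lattice of torsion classes ordered by inclusion, and $\mathsf{T}(\mathcal{C})$ is the smallest torsion class containing a class $\mathcal{C}$ of objects. A wide subcategory is a non-empty subcategory closed under kernels, cokernels and extensions; $\mathsf{wide}\,\mathcal{A}$ is the set of them. A torsion class is widely generated if it equals $\mathsf{T}(\mathcal{W})$ for some wide subcategory $\mathcal{W}$. A brick is an object whose endomorphism ring is a division ring; a semibrick is a set of isomorphism classes of bricks such that there is no non-zero morphism between non-isomorphic members; $\mathsf{sbrick}\,\mathcal{A}$ is the set of semibricks. $\mathsf{Filt}(\mathcal{C})$ is the subcategory of all $M$ with a finite filtration $0=M_0\subseteq M_1\subseteq\cdots\subseteq M_n=M$ with all $M_i/M_{i-1}\in\mathcal{C}$. $\mathsf{simp}\,\mathcal{W}$ is the set of isomorphism classes of simple objects of the abelian category $\mathcal{W}$. For $\mathcal{T}\in\mathsf{tors}\,\mathcal{A}$ let $$\mathsf{W}_L(\mathcal{T})=\{W\in\mathcal{T}\mid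 \ker f\in\mathcal{T}\text{ for every } f\colon T\to W \text{ with } T\in\mathcal{T}\}.$$ For an element $x$ of a complete lattice $L$, a canonical join representation of $x$ is an antichain $A\subseteq L$ with $x=\bigvee A$ such that, for every $B\subseteq L$ with $x=\bigvee B$, each $a\in A$ satisfies $a\le b$ for some $b\in B$. It is unique if it exists and is then denoted $\mathrm{CJR}(x)$; $L_0$ is the set of $x\in L$ for which it exists. For $\mathcal{T}\in(\mathsf{tors}\,\mathcal{A})_0$ let $\overline{\mathrm{CJR}}(\mathcal{T})$ be the set of isomorphism classes of bricks $B$ with $\mathsf{T}(B)\in\mathrm{CJR}(\mathcal{T})$. Then: 1. A torsion class $\mathcal{T}$ is widely generated if and only if $\mathrm{CJR}(\mathcal{T})$ exists in $\mathsf{tors}\,\mathcal{A}$. 2. $\mathsf{T}\colon\mathsf{wide}\,\mathcal{A}\to(\mathsf{tors}\,\mathcal{A})_0$ and $\mathsf{W}_L\colon(\mathsf{tors}\,\mathcal{A})_0\to\mathsf{wide}\,\mathcal{A}$ are mutually inverse bijections. 3. $\overline{\mathrm{CJR}}(\mathcal{T})$ is a semibrick for every $\mathcal{T}\in(\mathsf{tors}\,\mathcal{A})_0$,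 and $\mathsf{T}\colon\mathsf{sbrick}\,\mathcal{A}\to(\mathsf{tors}\,\mathcal{A})_0$ and $\overline{\mathrm{CJR}}\colon(\mathsf{tors}\,\mathcal{A})_0\to\mathsf{sbrick}\,\mathcal{A}$ are mutually inverse bijections. 4. $\mathsf{Filt}\colon\mathsf{sbrick}\,\mathcal{A}\to\mathsf{wide}\,\mathcal{A}$ and $\mathsf{simp}\colon\mathsf{wide}\,\mathcal{A}\to\mathsf{sbrick}\,\mathcal{A}$ are mutually inverse bijections, and they are compatible with the bijections in 2 and 3: $\mathsf{T}(\mathsf{Filt}\,\mathcal{S})=\mathsf{T}(\mathcal{S})$ for $\mathcal{S}\in\mathsf{sbrick}\,\mathcal{A}$, $\mathsf{T}(\mathsf{simp}\,\mathcal{W})=\mathsf{T}(\mathcal{W})$ for $\mathcal{W}\in\mathsf{wide}\,\mathcal{A}$, and $\mathsf{Filt}(\overline{\mathrm{CJR}}(\mathcal{T}))=\mathsf{W}_L(\mathcal{T})$ and $\mathsf{simp}(\mathsf{W}_L(\mathcal{T}))=\overline{\mathrm{CJR}}(\mathcal{T})$ for $\mathcal{T}\in(\mathsf{tors}\,\mathcal{A})_0$.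 -/

import Mathlib

open CategoryTheory CategoryTheory.Limits

universe v u

namespace TorsWide

section Lattice

variable {L : Type u} [CompleteLattice L]

/-- `x = ⋁ A` is a canonical join representation of `x` (in the complete sense): `A` refines every
subset `B` with `x = ⋁ B`, infinite ones and redundant ones included, and `A` is an antichain. -/
structure IsCanonicalJoinRep (x : L) (A : Set L) : Prop where
  sSup_eq : x = sSup A
  refines : ∀ B : Set L, x = sSup B → ∀ a ∈ A, ∃ b ∈ B, a ≤ b
  antichain : ∀ a₁ ∈ A, ∀ a₂ ∈ A, a₁ ≤ a₂ → a₁ = a₂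

/-- A canonical join representation is unique if it exists. -/
theorem IsCanonicalJoinRep.unique {x : L} {A B : Set L}
    (hA : IsCanonicalJoinRep x A) (hB : IsCanonicalJoinRep x B) : A = B := by
  have key : ∀ {A B : Set L}, IsCanonicalJoinRep x A → IsCanonicalJoinRep x B → A ⊆ B := by
    intro A B hA hB a ha
    obtain ⟨b, hb, hab⟩ := hA.refines B hB.sSup_eq a ha
    obtain ⟨a', ha', hba'⟩ := hB.refines A hA.sSup_eq b hb
    have h := hA.antichain a ha a' ha' (hab.trans hba')
    have h2 : a = b := le_antisymm hab (h ▸ hba')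
    exact h2 ▸ hb
  exact Set.Subset.antisymm (key hA hB) (key hB hA)

variable (L) in
/-- The set `L₀` of elements that have a canonical join representation. -/
def canonicalElements : Set L := {x | ∃ A : Set L, IsCanonicalJoinRep x A}

/-- The canonical join representation of `x`, if it exists; the empty set otherwise. -/
def CJR (x : L) : Set L := {a | ∃ A : Set L, IsCanonicalJoinRep x A ∧ a ∈ A}

theorem IsCanonicalJoinRep.cjr_eq {x : L} {A : Set L} (hA : IsCanonicalJoinRep x A) :
    CJR x = A := by
  ext a
  constructor
  · rintro ⟨B, hB, ha⟩
    exact hA.unique hB ▸ ha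
  · intro ha
    exact ⟨A, hA, ha⟩

end Lattice

section Category

variable {C : Type u} [Category.{v} C] [Abelian C]

/-- `Filt P`: the objects `M` with a finite filtration `0 = M₀ ⊆ M₁ ⊆ ⋯ ⊆ Mₙ = M` all of whose
factors `Mᵢ₊₁ / Mᵢ` are isomorphic to objects in `P`. -/
def Filt (P : ObjectProperty C) : ObjectProperty C := fun M =>
  ∃ (n : ℕ) (F : ℕ → Subobject M) (hF : Monotone F), F 0 = ⊥ ∧ F n = ⊤ ∧
    ∀ i < n, P.isoClosure (cokernel ((F i).ofLE (F (i + 1)) (hF (Nat.le_succ i))))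

variable (C) in
/-- An abelian category is a length category if every object has a composition series, that is, a
finite filtration with simple factors. -/
def IsLengthCategory : Prop := ∀ M : C, Filt (fun X : C => Simple X) M

/-- Torsion classes: closed under quotients and extensions (and containing zero objects). -/
structure IsTorsionClass (P : ObjectProperty C) : Prop extends
  P.ContainsZero, P.IsClosedUnderQuotients, P.IsClosedUnderExtensions

/-- Wide subcategories: closed under kernels, cokernels and extensions (and containing zero
objects). -/
structure IsWide (P : ObjectProperty C) : Prop extends
  P.ContainsZero, P.IsClosedUnderKernels, P.IsClosedUnderCokernels, P.IsClosedUnderExtensions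

variable (C) in
/-- The set of wide subcategories. -/
def wide : Set (ObjectProperty C) := {W | IsWide W}

variable (C) in
/-- The poset of torsion classes, ordered by inclusion. -/
abbrev Tors : Type u := {P : ObjectProperty C // IsTorsionClass P}

/-- An intersection of torsion classes is a torsion class. -/
theorem isTorsionClass_inter (S : Set (Tors C)) :
    IsTorsionClass (fun X : C => ∀ T ∈ S, T.1 X) where
  exists_zero := ⟨_, isZero_zero C, fun T _ => by
    have := T.2.toContainsZero
    have := T.2.toIsClosedUnderQuotients
    exact T.1.prop_of_isZero (isZero_zero C)⟩
  prop_of_epi f _ hX := fun T hT => T.2.prop_of_epi f (hX T hT)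
  prop_X₂_of_shortExact hS h₁ h₃ := fun T hT =>
    T.2.prop_X₂_of_shortExact hS (h₁ T hT) (h₃ T hT)

instance : InfSet (Tors C) := ⟨fun S => ⟨fun X => ∀ T ∈ S, T.1 X, isTorsionClass_inter S⟩⟩

/-- Torsion classes form a complete lattice, in which meets are intersections. -/
noncomputable instance : CompleteLattice (Tors C) :=
  completeLatticeOfInf (Tors C) fun _ =>
    ⟨fun _ hT _ hX => hX _ hT, fun _ hU X hX T hT => hU hT X hX⟩

/-- `torsGen P` is the smallest torsion class that contains `P`. -/
noncomputable def torsGen (P : ObjectProperty C) : Tors C := sInf {T : Tors C | P ≤ T.1}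

theorem isLeast_torsGen (P : ObjectProperty C) :
    IsLeast {T : Tors C | P ≤ T.1} (torsGen P) :=
  ⟨fun _ hX _ hT => hT _ hX, fun _ hT => sInf_le hT⟩

/-- A torsion class is widely generated if it is the smallest torsion class containing some wide
subcategory. -/
def IsWidelyGenerated (T : Tors C) : Prop := ∃ W ∈ wide C, T = torsGen W

/-- A brick is an object whose endomorphism ring is a division ring. -/
def IsBrick (B : C) : Prop := Nontrivial (End B) ∧ ∀ f : End B, f ≠ 0 → IsUnit f

/-- A semibrick, i.e. a set of isomorphism classes of pairwise Hom-orthogonal bricks, given as the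
isomorphism-closed class of the objects that represent them. -/
structure IsSemibrick (S : ObjectProperty C) : Prop extends S.IsClosedUnderIsomorphisms where
  isBrick : ∀ B : C, S B → IsBrick B
  hom_eq_zero : ∀ B₁ B₂ : C, S B₁ → S B₂ → ¬ Nonempty (B₁ ≅ B₂) → ∀ f : B₁ ⟶ B₂, f = 0

variable (C) in
/-- The set of semibricks. -/
def sbrick : Set (ObjectProperty C) := {S | IsSemibrick S}

/-- `simp W`: the objects of `W` that are simple objects of the category `W` itself. -/
def simp (W : ObjectProperty C) : ObjectProperty C := fun X =>
  ∃ h : W X, Simple (⟨X, h⟩ : W.FullSubcategory)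

/-- `W_L(T)`: the objects `W` of `T` such that all morphisms from objects of `T` to `W` have their
kernel in `T`. -/
def WL (T : Tors C) : ObjectProperty C := fun W =>
  T.1 W ∧ ∀ (X : C) (f : X ⟶ W), T.1 X → T.1 (kernel f)

/-- The brick version of `CJR`: the bricks `B` for which the torsion class generated by `B` is an
element of `CJR T`. -/
def brickCJR (T : Tors C) : ObjectProperty C := fun B =>
  IsBrick B ∧ torsGen (ObjectProperty.singleton B) ∈ CJR T

end Category

end TorsWide

open TorsWide

namespace TorsWide

/-! ### Kernels, cokernels and extensions in an abelian category. -/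

section Toolkit

variable {C : Type u} [Category.{v} C] [Abelian C]

/-! Everything is reduced to semibricks. An object lies in `torsGen P` exactly when each of its
non-zero quotients receives a non-zero map from `P` (`exists_hom_ne_zero`, `mem_of_homGenerated`).
For a semibrick `S` this makes every non-zero map from `torsGen S` to a brick of `S` epi
(`IsSemibrick.epi`), with kernel again in `torsGen S` (`IsSemibrick.kernel_mem`). Hence `S ≤ WL
(torsGen S)`, and a maximality argument gives `WL (torsGen S) = Filt S`, which is therefore wide.
Schur's lemma in a wide `W` makes `simp W` a semibrick, and `Filt` and `simp` are inverse to each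
other.

On the lattice side, if `torsGen S` is a join of torsion classes, each brick `B` of `S` receives a
non-zero map, hence an epi, from a member of one of them, so `B` lies in it. The classes generated
by single bricks thus form the canonical join representation. Conversely, every member of such a
representation is generated by one brick, as any torsion class is the join of those of its bricks. A
non-zero map between two non-isomorphic such bricks would let one of them be replaced by a proper
quotient, against canonicity.

Length enters through a superadditive function that vanishes only on zero objects; it supplies the
minimal subobjects and maximal quotient kernels. -/

theorem shortExact_of_epi {X Y : C} (p : X ⟶ Y) [Epi p] :
    (ShortComplex.mk (kernel.ι p) p (kernel.condition p)).ShortExact where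
  exact := ShortComplex.exact_of_f_is_kernel _ (kernelIsKernel p)

theorem shortExact_of_mono {X Y : C} (i : X ⟶ Y) [Mono i] :
    (ShortComplex.mk i (cokernel.π i) (cokernel.condition i)).ShortExact where
  exact := ShortComplex.exact_of_g_is_cokernel _ (cokernelIsCokernel i)

noncomputable def kernelIso {S : ShortComplex C} (hS : S.ShortExact) : S.X₁ ≅ kernel S.g :=
  IsLimit.conePointUniqueUpToIso (s := KernelFork.ofι S.f S.zero) hS.fIsKernel
    (limit.isLimit _)

noncomputable def cokernelIso {S : ShortComplex C} (hS : S.ShortExact) : cokernel S.f ≅ S.X₃ :=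
  IsColimit.coconePointUniqueUpToIso (t := CokernelCofork.ofπ S.g S.zero)
    (colimit.isColimit _) hS.gIsCokernel

/-- The kernel of a composition with an epimorphism is an extension of kernels. -/
theorem shortExact_kernel_comp {X Y Z : C} (f : X ⟶ Y) (g : Y ⟶ Z) [Epi f] :
    (ShortComplex.mk (kernel.lift (f ≫ g) (kernel.ι f) (by simp))
      (kernel.map (f ≫ g) g f (𝟙 Z) (by simp)) (by ext; simp)).ShortExact := by
  have sq : IsPullback (kernel.ι (f ≫ g)) (kernel.map (f ≫ g) g f (𝟙 Z) (by simp)) f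
      (kernel.ι g) := by
    refine ⟨⟨by simp⟩, ⟨PullbackCone.IsLimit.mk _
      (fun s => kernel.lift _ s.fst (by
        have := s.condition
        rw [← Category.assoc, this, Category.assoc, kernel.condition, comp_zero])) ?_ ?_ ?_⟩⟩
    · intro s; simp
    · intro s; ext; simp [s.condition]
    · intro s m h₁ h₂; ext; simp [h₁]
  have h_epi : Epi (kernel.map (f ≫ g) g f (𝟙 Z) (by simp)) :=
    (inferInstance : (MorphismProperty.epimorphisms C).IsStableUnderBaseChange).of_isPullback
      sq (MorphismProperty.epimorphisms.infer_property f)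
  have h_mono : Mono (kernel.lift (f ≫ g) (kernel.ι f) (by simp)) :=
    have : Mono (kernel.lift (f ≫ g) (kernel.ι f) (by simp) ≫ kernel.ι (f ≫ g)) := by
      rw [kernel.lift_ι]; infer_instance
    mono_of_mono _ (kernel.ι (f ≫ g))
  refine ShortComplex.ShortExact.mk' (ShortComplex.exact_of_f_is_kernel _ ?_) h_mono h_epi
  refine KernelFork.IsLimit.ofι' _ _ fun {A} k hk => ⟨kernel.lift f (k ≫ kernel.ι _) ?_, ?_⟩
  · have := congrArg (· ≫ kernel.ι g) hk
    simpa using this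
  · ext; simp

/-- The cokernel of a composition with a monomorphism is an extension of cokernels. -/
theorem shortExact_cokernel_comp {X Y Z : C} (f : X ⟶ Y) (g : Y ⟶ Z) [Mono g] :
    (ShortComplex.mk (cokernel.map f (f ≫ g) (𝟙 X) g (by simp))
      (cokernel.desc (f ≫ g) (cokernel.π g) (by simp)) (by ext; simp)).ShortExact := by
  have sq : IsPushout (cokernel.π f) g (cokernel.map f (f ≫ g) (𝟙 X) g (by simp))
      (cokernel.π (f ≫ g)) := by
    refine ⟨⟨by simp⟩, ⟨PushoutCocone.IsColimit.mk _
      (fun s => cokernel.desc _ s.inr (by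
        have := s.condition
        rw [Category.assoc, ← this, cokernel.condition_assoc, zero_comp])) ?_ ?_ ?_⟩⟩
    · intro s; ext; simp [s.condition]
    · intro s; simp
    · intro s m h₁ h₂; ext; simp [h₂]
  have h_mono : Mono (cokernel.map f (f ≫ g) (𝟙 X) g (by simp)) :=
    (inferInstance : (MorphismProperty.monomorphisms C).IsStableUnderCobaseChange).of_isPushout
      sq (MorphismProperty.monomorphisms.infer_property g)
  have h_epi : Epi (cokernel.desc (f ≫ g) (cokernel.π g) (by simp)) :=
    have : Epi (cokernel.π (f ≫ g) ≫ cokernel.desc (f ≫ g) (cokernel.π g) (by simp)) := by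
      rw [cokernel.π_desc]; infer_instance
    epi_of_epi (cokernel.π (f ≫ g)) _
  refine ShortComplex.ShortExact.mk' (ShortComplex.exact_of_g_is_cokernel _ ?_) h_mono h_epi
  refine CokernelCofork.IsColimit.ofπ' _ _ fun {A} k hk =>
    ⟨cokernel.desc g (cokernel.π _ ≫ k) ?_, ?_⟩
  · have := congrArg (cokernel.π f ≫ ·) hk
    simpa using this
  · ext; simp

/-- The intersection of two kernels, computed in two ways. -/
noncomputable def kernelKernelIso {X Y Z : C} (f : X ⟶ Y) (g : X ⟶ Z) :
    kernel (kernel.ι f ≫ g) ≅ kernel (kernel.ι g ≫ f) where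
  hom := kernel.lift _ (kernel.lift _ (kernel.ι _ ≫ kernel.ι f) (by simp)) (by simp)
  inv := kernel.lift _ (kernel.lift _ (kernel.ι _ ≫ kernel.ι g) (by simp)) (by simp)
  hom_inv_id := by ext; simp
  inv_hom_id := by ext; simp

/-- Both conditions say that the two kernels together span `X`, which is symmetric. -/
theorem epi_kernel_ι_comp {X Y Z : C} (f : X ⟶ Y) (g : X ⟶ Z) [Epi f] [Epi g]
    [Epi (kernel.ι f ≫ g)] : Epi (kernel.ι g ≫ f) := by
  refine Preadditive.epi_of_cancel_zero _ fun {W} t ht => ?_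
  obtain ⟨s, hs⟩ : ∃ s, g ≫ s = f ≫ t :=
    ⟨(shortExact_of_epi g).exact.desc (f ≫ t) (by simpa using ht),
      (shortExact_of_epi g).exact.g_desc _ _⟩
  have : s = 0 := by
    rw [← cancel_epi (kernel.ι f ≫ g), Category.assoc, hs]
    simp
  rw [← cancel_epi f, ← hs, this]
  simp

/-- The kernel of a morphism is the kernel of its base change. -/
noncomputable def kernelPullbackFstIso {X Y Z : C} (f : X ⟶ Z) (g : Y ⟶ Z) :
    kernel (pullback.fst f g) ≅ kernel g where
  hom := kernel.lift _ (kernel.ι _ ≫ pullback.snd f g) (by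
    rw [Category.assoc, ← pullback.condition, kernel.condition_assoc, zero_comp])
  inv := kernel.lift _ (pullback.lift 0 (kernel.ι g) (by simp)) (by rw [pullback.lift_fst])
  hom_inv_id := by ext <;> simp [pullback.lift_fst, pullback.lift_snd]
  inv_hom_id := by ext; simp [pullback.lift_snd]

noncomputable def kernelPullbackSndIso {X Y Z : C} (f : X ⟶ Z) (g : Y ⟶ Z) :
    kernel (pullback.snd f g) ≅ kernel f where
  hom := kernel.lift _ (kernel.ι _ ≫ pullback.fst f g) (by
    rw [Category.assoc, pullback.condition, kernel.condition_assoc, zero_comp])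
  inv := kernel.lift _ (pullback.lift (kernel.ι f) 0 (by simp)) (by rw [pullback.lift_snd])
  hom_inv_id := by ext <;> simp [pullback.lift_fst, pullback.lift_snd]
  inv_hom_id := by ext; simp [pullback.lift_fst]

theorem exists_image_fac {X Y : C} (f : X ⟶ Y) :
    ∃ (I : C) (e : X ⟶ I) (m : I ⟶ Y), Epi e ∧ Mono m ∧ e ≫ m = f :=
  ⟨Abelian.image f, Abelian.factorThruImage f, Abelian.image.ι f, inferInstance, inferInstance,
    Abelian.image.fac f⟩

theorem not_isZero_of_ne_zero {X Y : C} {f : X ⟶ Y} (hf : f ≠ 0) : ¬IsZero X :=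
  fun h => hf (h.eq_of_src _ _)

theorem epi_ne_zero {X Y : C} {f : X ⟶ Y} [Epi f] (hY : ¬IsZero Y) : f ≠ 0 := by
  rintro rfl
  exact hY (IsZero.of_epi_zero X Y)

theorem mono_ne_zero {X Y : C} {f : X ⟶ Y} [Mono f] (hX : ¬IsZero X) : f ≠ 0 := by
  rintro rfl
  exact hX (IsZero.of_mono_zero X Y)

/-- A class closed under extensions, with a zero object, is closed under isomorphisms. -/
theorem prop_of_iso_of_ext {P : ObjectProperty C} [P.ContainsZero] [P.IsClosedUnderExtensions]
    {X Y : C} (e : X ≅ Y) (hX : P X) : P Y := by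
  obtain ⟨Z, hZ, hPZ⟩ := P.exists_prop_of_containsZero
  -- `Y` is an extension of `X` by a zero object.
  let S := ShortComplex.mk (0 : Z ⟶ Y) e.inv (by simp)
  have hg : Mono S.g := inferInstanceAs (Mono e.inv)
  have hS : S.ShortExact := .mk' ((ShortComplex.exact_iff_mono S rfl).2 hg)
    ⟨fun _ _ _ => hZ.eq_of_tgt _ _⟩ (inferInstanceAs (Epi e.inv))
  exact P.prop_X₂_of_shortExact hS hPZ hX

theorem prop_of_isZero_of_ext {P : ObjectProperty C} [P.ContainsZero] [P.IsClosedUnderExtensions]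
    {X : C} (hX : IsZero X) : P X := by
  obtain ⟨Z, hZ, hPZ⟩ := P.exists_prop_of_containsZero
  exact prop_of_iso_of_ext (hZ.iso hX) hPZ

theorem prop_of_epi_of_ext {P : ObjectProperty C} [P.IsClosedUnderExtensions]
    {X Y : C} (p : X ⟶ Y) [Epi p] (hK : P (kernel p)) (hY : P Y) : P X :=
  P.prop_X₂_of_shortExact (shortExact_of_epi p) hK hY

end Toolkit

/-! ### Filtrations as iterated extensions. -/

section Filtration

variable {C : Type u} [Category.{v} C] [Abelian C]

/-- Objects obtained from zero by `n` successive extensions by objects in `P`. -/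
inductive IterExt (P : ObjectProperty C) : ℕ → C → Prop
  | zero {M : C} (hM : IsZero M) : IterExt P 0 M
  | ext {n : ℕ} {S : ShortComplex C} (hS : S.ShortExact) (h₁ : IterExt P n S.X₁)
      (h₃ : P.isoClosure S.X₃) : IterExt P (n + 1) S.X₂

theorem IterExt.of_iso {P : ObjectProperty C} {n : ℕ} {M N : C} (e : M ≅ N)
    (h : IterExt P n M) : IterExt P n N := by
  cases h with
  | zero hM => exact .zero (hM.of_iso e.symm)
  | @ext n S hS h₁ h₃ =>
    refine IterExt.ext (S := ShortComplex.mk (S.f ≫ e.hom) (e.inv ≫ S.g) (by simp)) ?_ h₁ h₃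
    exact ShortComplex.shortExact_of_iso
      (ShortComplex.isoMk (Iso.refl S.X₁) e (Iso.refl S.X₃) (by simp) (by simp)) hS

theorem IterExt.of_epi {P : ObjectProperty C} {n : ℕ} {M N : C} (p : M ⟶ N) [Epi p]
    (h₁ : IterExt P n (kernel p)) (h₃ : P.isoClosure N) : IterExt P (n + 1) M :=
  IterExt.ext (shortExact_of_epi p) h₁ h₃

theorem IterExt.exists_epi {P : ObjectProperty C} {n : ℕ} {M : C} (h : IterExt P (n + 1) M) :
    ∃ (N : C) (p : M ⟶ N), Epi p ∧ P.isoClosure N ∧ IterExt P n (kernel p) := by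
  cases h with
  | @ext n S hS h₁ h₃ =>
    exact ⟨_, S.g, hS.epi_g, h₃, h₁.of_iso (kernelIso hS)⟩

theorem IterExt.isZero {P : ObjectProperty C} {M : C} (h : IterExt P 0 M) : IsZero M := by
  cases h; assumption

theorem IterExt.prop {P Q : ObjectProperty C} [Q.ContainsZero] [Q.IsClosedUnderExtensions]
    (hPQ : P ≤ Q) {n : ℕ} {M : C} (h : IterExt P n M) : Q M := by
  induction h with
  | zero hM => exact prop_of_isZero_of_ext hM
  | ext hS _ h₃ ih =>
    obtain ⟨Y, hY, ⟨e⟩⟩ := h₃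
    exact Q.prop_X₂_of_shortExact hS ih (prop_of_iso_of_ext e.symm (hPQ _ hY))

/-- The quotient of two consecutive members of a filtration lies in `P`, up to isomorphism. -/
def IsStep (P : ObjectProperty C) {M : C} (X Y : Subobject M) : Prop :=
  ∃ h : X ≤ Y, P.isoClosure (cokernel (X.ofLE Y h))

theorem isStep_of_iso {P : ObjectProperty C} {M A B : C} {X Y : Subobject M} (h : X ≤ Y)
    (g : A ⟶ B) (eX : (X : C) ≅ A) (eY : (Y : C) ≅ B) (w : X.ofLE Y h ≫ eY.hom = eX.hom ≫ g)
    (hg : P.isoClosure (cokernel g)) : IsStep P X Y :=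
  ⟨h, P.isoClosure.prop_of_iso (cokernel.mapIso _ _ eX eY w).symm hg⟩

theorem IsStep.map {P : ObjectProperty C} {M N : C} (i : M ⟶ N) [Mono i] {X Y : Subobject M}
    (h : IsStep P X Y) : IsStep P ((Subobject.map i).obj X) ((Subobject.map i).obj Y) := by
  obtain ⟨hXY, hP⟩ := h
  have e : ∀ Z : Subobject M, ∃ f : (((Subobject.map i).obj Z : Subobject N) : C) ≅ (Z : C),
      f.hom ≫ Z.arrow ≫ i = ((Subobject.map i).obj Z).arrow := by
    intro Z
    have h : (Subobject.map i).obj Z = Subobject.mk (Z.arrow ≫ i) := by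
      rw [← Subobject.map_mk, Subobject.mk_arrow]
    exact ⟨Subobject.isoOfEqMk _ (Z.arrow ≫ i) h,
      by rw [Subobject.isoOfEqMk_hom, Subobject.ofLEMk_comp]⟩
  obtain ⟨eX, hX⟩ := e X
  obtain ⟨eY, hY⟩ := e Y
  refine isStep_of_iso ((Subobject.map i).monotone hXY) (X.ofLE Y hXY) eX eY ?_ hP
  rw [← cancel_mono (Y.arrow ≫ i)]
  simp [hX, hY]

theorem isStep_mk_top {P : ObjectProperty C} {M N : C} (i : M ⟶ N) [Mono i]
    (h : P.isoClosure (cokernel i)) : IsStep P (Subobject.mk i) ⊤ :=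
  isStep_of_iso le_top i (Subobject.underlyingIso i) (asIso (⊤ : Subobject N).arrow) (by simp) h

theorem IterExt.filt {P : ObjectProperty C} {n : ℕ} {M : C} (h : IterExt P n M) :
    ∃ F : ℕ → Subobject M, F 0 = ⊥ ∧ F n = ⊤ ∧ Monotone F ∧ ∀ i < n, IsStep P (F i) (F (i + 1)) := by
  induction h with
  | zero hM =>
    have := Subobject.subsingleton_of_isZero hM
    exact ⟨fun _ => ⊥, rfl, Subsingleton.elim _ _, monotone_const, by simp⟩
  | @ext n S hS h₁ h₃ ih =>
    obtain ⟨F, h0, hn, hmono, hstep⟩ := ih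
    have := hS.mono_f
    -- Push the filtration of `S.X₁` into `S.X₂` and append `⊤`; the new last factor is `S.X₃`.
    refine ⟨fun i => if i ≤ n then (Subobject.map S.f).obj (F i) else ⊤, ?_, ?_, ?_, ?_⟩
    · simp only [zero_le, if_true, h0]
      exact Subobject.map_bot _
    · simp
    · intro i j hij
      dsimp only
      by_cases hj : j ≤ n
      · rw [if_pos hj, if_pos (hij.trans hj)]
        exact (Subobject.map S.f).monotone (hmono hij)
      · rw [if_neg hj]
        exact le_top
    · intro i hi
      dsimp only
      rcases Nat.lt_succ_iff_lt_or_eq.1 hi with hi | rfl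
      · rw [if_pos hi.le, if_pos (Nat.succ_le_of_lt hi)]
        exact (hstep i hi).map _
      · rw [if_pos le_rfl, if_neg (by omega), hn, Subobject.map_top]
        exact isStep_mk_top _ (P.isoClosure.prop_of_iso (cokernelIso hS).symm h₃)

theorem filt_iff {P : ObjectProperty C} {M : C} : Filt P M ↔ ∃ n, IterExt P n M := by
  constructor
  · rintro ⟨n, F, hF, h0, hn, hstep⟩
    have key : ∀ i ≤ n, IterExt P i (F i : C) := by
      intro i
      induction i with
      | zero =>
        intro _
        rw [h0]
        exact .zero ((isZero_zero C).of_iso Subobject.botCoeIsoZero)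
      | succ i ih =>
        intro hi
        exact IterExt.ext (shortExact_of_mono ((F i).ofLE (F (i + 1)) (hF (Nat.le_succ i))))
          (ih (by omega)) (hstep i hi)
    have h := key n le_rfl
    rw [hn] at h
    exact ⟨n, h.of_iso (asIso (⊤ : Subobject M).arrow)⟩
  · rintro ⟨n, h⟩
    obtain ⟨F, h0, hn, hmono, hstep⟩ := h.filt
    exact ⟨n, F, hmono, h0, hn, fun i hi => (hstep i hi).2⟩

instance (P : ObjectProperty C) : (Filt P).ContainsZero where
  exists_zero := ⟨_, isZero_zero C, filt_iff.2 ⟨0, .zero (isZero_zero C)⟩⟩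

/-- Peel the top factor off the quotient: the kernel of `q ≫ p` is an extension of `kernel p` by
`kernel q`, so induction on the quotient's filtration applies. -/
instance (P : ObjectProperty C) : (Filt P).IsClosedUnderExtensions where
  prop_X₂_of_shortExact {S} hS h₁ h₃ := by
    obtain ⟨m, h₁⟩ := filt_iff.1 h₁
    obtain ⟨n, h₃⟩ := filt_iff.1 h₃
    refine filt_iff.2 ⟨m + n, ?_⟩
    have key : ∀ (n : ℕ) {M N : C} (q : M ⟶ N) (_ : Epi q), IterExt P m (kernel q) →
        IterExt P n N → IterExt P (m + n) M := by
      intro n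
      induction n with
      | zero =>
        intro M N q _ hK hN
        have : IsIso (kernel.ι q) := by
          have := (shortExact_of_epi q).isIso_f_iff.2 hN.isZero
          exact this
        exact hK.of_iso (asIso (kernel.ι q))
      | succ n ih =>
        intro M N q _ hK hN
        obtain ⟨B, p, _, hB, hp⟩ := hN.exists_epi
        refine IterExt.of_epi (q ≫ p) ?_ hB
        have hE := shortExact_kernel_comp q p
        exact ih _ hE.epi_g
          (hK.of_iso (kernelIso hE)) hp
    have := hS.epi_g
    exact key n S.g inferInstance
      (h₁.of_iso (kernelIso hS)) h₃

theorem le_filt (P : ObjectProperty C) : P ≤ Filt P := fun X hX => by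
  refine filt_iff.2 ⟨1, IterExt.of_epi (𝟙 X) (.zero ?_) (P.le_isoClosure _ hX)⟩
  exact (isZero_zero C).of_iso (kernel.ofMono (𝟙 X))

theorem filt_le {P Q : ObjectProperty C} [Q.ContainsZero] [Q.IsClosedUnderExtensions]
    (hPQ : P ≤ Q) : Filt P ≤ Q := fun _ hM => (filt_iff.1 hM).choose_spec.prop hPQ

end Filtration

/-! ### A length function. -/

section Length

variable {C : Type u} [Category.{v} C] [Abelian C]

/-- The simple top factor of `M` belongs to exactly one side: it is a quotient of `B` if `p` kills
`kernel q`, and otherwise of `kernel q`. Induction on `kernel p` distributes the rest. -/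
theorem IterExt.split_of_epi {n : ℕ} {M : C} (h : IterExt (fun X : C => Simple X) n M) :
    ∀ {B : C} (q : M ⟶ B) [Epi q], ∃ a b, IterExt (fun X : C => Simple X) a (kernel q) ∧
      IterExt (fun X : C => Simple X) b B ∧ a + b = n := by
  induction n generalizing M with
  | zero =>
    intro B q _
    exact ⟨0, 0, .zero (h.isZero.of_mono (kernel.ι q)), .zero (h.isZero.of_epi q), rfl⟩
  | succ n ih =>
    intro B q _
    obtain ⟨S, p, _, hS, hK⟩ := h.exists_epi
    have hS' : Simple S := by
      obtain ⟨Y, hY, ⟨e⟩⟩ := hS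
      have : Simple Y := hY
      exact Simple.of_iso e
    by_cases h0 : kernel.ι q ≫ p = 0
    · obtain ⟨r, rfl⟩ : ∃ r, q ≫ r = p :=
        ⟨(shortExact_of_epi q).exact.desc p h0, (shortExact_of_epi q).exact.g_desc _ _⟩
      have : Epi r := epi_of_epi q r
      have hE := shortExact_kernel_comp q r
      have := hE.epi_g
      obtain ⟨a, b, ha, hb, hab⟩ := ih hK (kernel.map (q ≫ r) r q (𝟙 S) (by simp))
      exact ⟨a, b + 1, ha.of_iso (kernelIso hE).symm,
        hb.of_epi r hS, by omega⟩
    · have : Epi (kernel.ι q ≫ p) := epi_of_nonzero_to_simple h0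
      have : Epi (kernel.ι p ≫ q) := epi_kernel_ι_comp q p
      obtain ⟨a, b, ha, hb, hab⟩ := ih hK (kernel.ι p ≫ q)
      exact ⟨a + 1, b, (ha.of_iso (kernelKernelIso p q)).of_epi (kernel.ι q ≫ p) hS, hb, by omega⟩

/-- Every length category has a superadditive length that only vanishes on zero objects. -/
theorem exists_length (hC : IsLengthCategory C) : ∃ l : C → ℕ,
    (∀ X, l X = 0 → IsZero X) ∧ ∀ S : ShortComplex C, S.ShortExact → l S.X₁ + l S.X₃ ≤ l S.X₂ := by
  classical
  have h : ∀ X : C, ∃ n, IterExt (fun X : C => Simple X) n X := fun X => filt_iff.1 (hC X)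
  -- The length is that of a shortest filtration; splitting one of the middle term bounds both ends.
  refine ⟨fun X => Nat.find (h X), fun X hX => ?_, fun S hS => ?_⟩
  · have := Nat.find_spec (h X)
    dsimp only at hX
    rw [hX] at this
    exact this.isZero
  · have := hS.epi_g
    obtain ⟨a, b, ha, hb, hab⟩ := (Nat.find_spec (h S.X₂)).split_of_epi S.g
    have h₁ := Nat.find_min' (h S.X₁)
      (ha.of_iso (kernelIso hS).symm)
    have h₃ := Nat.find_min' (h S.X₃) hb
    dsimp only
    omega

end Length

/-! ### Extremal quotients and subobjects. -/

section Maximal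

variable {C : Type u} [Category.{v} C] [Abelian C]

theorem length_mono {l : C → ℕ}
    (hl : ∀ S : ShortComplex C, S.ShortExact → l S.X₁ + l S.X₃ ≤ l S.X₂)
    {X Y : C} (i : X ⟶ Y) [Mono i] : l X + l (cokernel i) ≤ l Y :=
  hl _ (shortExact_of_mono i)

theorem length_epi {l : C → ℕ}
    (hl : ∀ S : ShortComplex C, S.ShortExact → l S.X₁ + l S.X₃ ≤ l S.X₂)
    {X Y : C} (p : X ⟶ Y) [Epi p] : l (kernel p) + l Y ≤ l X :=
  hl _ (shortExact_of_epi p)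

/-- Every object has a subobject in `P` whose quotient has no non-zero subobject in `P`. -/
theorem exists_quotient_torsionFree (hC : IsLengthCategory C) (P : ObjectProperty C)
    [P.ContainsZero] [P.IsClosedUnderExtensions] (M : C) :
    ∃ (Q : C) (p : M ⟶ Q), Epi p ∧ P (kernel p) ∧
      ∀ (Y : C) (g : Y ⟶ Q), Mono g → P Y → IsZero Y := by
  obtain ⟨l, hl0, hl⟩ := exists_length hC
  have hne : ∃ n, ∃ (Q : C) (p : M ⟶ Q), Epi p ∧ P (kernel p) ∧ l Q = n :=
    ⟨_, M, 𝟙 M, inferInstance,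
      prop_of_isZero_of_ext ((isZero_zero C).of_iso (kernel.ofMono (𝟙 M))), rfl⟩
  classical
  obtain ⟨Q, p, _, hp, hQ⟩ := Nat.find_spec hne
  refine ⟨Q, p, inferInstance, hp, fun Y g _ hY => hl0 _ ?_⟩
  -- `Q` has least length among the quotients with kernel in `P`. Dividing by `Y` too keeps the
  -- kernel in `P`, so it cannot shorten `Q`.
  have hE := shortExact_kernel_comp p (cokernel.π g)
  have hmin := Nat.find_min' hne ⟨cokernel g, p ≫ cokernel.π g, epi_comp _ _,
    P.prop_X₂_of_shortExact hE hp (prop_of_iso_of_ext (kernelIso (shortExact_of_mono g)) hY), rfl⟩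
  have := length_mono hl g
  omega

/-- Every non-zero subobject with property `P` contains a minimal one. -/
theorem exists_minimal_subobject (hC : IsLengthCategory C) (P : ObjectProperty C) {M : C}
    (hM : ¬IsZero M) (hP : P M) :
    ∃ (Y : C) (i : Y ⟶ M), Mono i ∧ P Y ∧ ¬IsZero Y ∧
      ∀ (Z : C) (j : Z ⟶ Y), Mono j → P Z → ¬IsZero Z → IsIso j := by
  obtain ⟨l, hl0, hl⟩ := exists_length hC
  have hne : ∃ n, ∃ (Y : C) (i : Y ⟶ M), Mono i ∧ P Y ∧ ¬IsZero Y ∧ l Y = n :=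
    ⟨_, M, 𝟙 M, inferInstance, hP, hM, rfl⟩
  classical
  obtain ⟨Y, i, _, hY, hY0, hlY⟩ := Nat.find_spec hne
  refine ⟨Y, i, inferInstance, hY, hY0, fun Z j _ hZ hZ0 => ?_⟩
  have hmin := Nat.find_min' hne ⟨Z, j ≫ i, mono_comp _ _, hZ, hZ0, rfl⟩
  have := length_mono hl j
  exact (shortExact_of_mono j).isIso_f_iff.2 (hl0 _ (show l (cokernel j) = 0 by omega))

theorem isIso_of_epi_endo (hC : IsLengthCategory C) {M : C} (f : M ⟶ M) [Epi f] : IsIso f := by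
  obtain ⟨l, hl0, hl⟩ := exists_length hC
  have := length_epi hl f
  exact (shortExact_of_epi f).isIso_g_iff.2 (hl0 _ (show l (kernel f) = 0 by omega))

end Maximal

/-! ### Generated torsion classes, tested by non-zero maps. -/

section Torsion

variable {C : Type u} [Category.{v} C] [Abelian C]

instance (T : Tors C) : T.1.ContainsZero := T.2.toContainsZero
instance (T : Tors C) : T.1.IsClosedUnderQuotients := T.2.toIsClosedUnderQuotients
instance (T : Tors C) : T.1.IsClosedUnderExtensions := T.2.toIsClosedUnderExtensions

theorem le_torsGen (P : ObjectProperty C) : P ≤ (torsGen P).1 := (isLeast_torsGen P).1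

theorem torsGen_le_iff {P : ObjectProperty C} {T : Tors C} : torsGen P ≤ T ↔ P ≤ T.1 :=
  ⟨fun h => (le_torsGen P).trans h, fun h => (isLeast_torsGen P).2 h⟩

theorem torsGen_mono {P Q : ObjectProperty C} (h : P ≤ Q) : torsGen P ≤ torsGen Q :=
  torsGen_le_iff.2 (h.trans (le_torsGen Q))

theorem torsGen_filt (P : ObjectProperty C) : torsGen (Filt P) = torsGen P :=
  le_antisymm (torsGen_le_iff.2 (filt_le (le_torsGen P))) (torsGen_mono (le_filt P))

theorem torsGen_singleton_le_iff {T : Tors C} {B : C} :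
    torsGen (ObjectProperty.singleton B) ≤ T ↔ T.1 B :=
  torsGen_le_iff.trans (by simp)

theorem mem_torsGen_singleton (B : C) : (torsGen (ObjectProperty.singleton B)).1 B :=
  torsGen_singleton_le_iff.1 le_rfl

theorem torsGen_singleton_congr {B B' : C} (e : B ≅ B') :
    torsGen (ObjectProperty.singleton B) = torsGen (ObjectProperty.singleton B') :=
  le_antisymm (torsGen_singleton_le_iff.2 (prop_of_iso_of_ext e.symm (mem_torsGen_singleton B')))
    (torsGen_singleton_le_iff.2 (prop_of_iso_of_ext e (mem_torsGen_singleton B)))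

/-- The objects all of whose non-zero quotients receive a non-zero morphism from `P`. -/
def HomGenerated (P : ObjectProperty C) : ObjectProperty C := fun M =>
  ∀ (N : C) (p : M ⟶ N), Epi p → ¬IsZero N → ∃ X, P X ∧ ∃ f : X ⟶ N, f ≠ 0

/-- A non-zero quotient of an extension either kills the subobject, so is a quotient of `S.X₃`, or
contains a non-zero image of `S.X₁`. -/
theorem isTorsionClass_homGenerated (P : ObjectProperty C) : IsTorsionClass (HomGenerated P) where
  exists_zero := ⟨_, isZero_zero C, fun _ p _ hN => absurd (IsZero.of_epi p (isZero_zero C)) hN⟩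
  prop_of_epi f _ hX := fun N p _ hN => hX N (f ≫ p) (epi_comp _ _) hN
  prop_X₂_of_shortExact {S} hS h₁ h₃ := fun N p _ hN => by
    by_cases h0 : S.f ≫ p = 0
    · have hfac : S.g ≫ hS.gIsCokernel.desc (CokernelCofork.ofπ p h0) = p :=
        hS.gIsCokernel.fac (CokernelCofork.ofπ p h0) WalkingParallelPair.one
      have : Epi (S.g ≫ hS.gIsCokernel.desc (CokernelCofork.ofπ p h0)) := by
        rw [hfac]; infer_instance
      exact h₃ N (hS.gIsCokernel.desc (CokernelCofork.ofπ p h0)) (epi_of_epi S.g _) hN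
    · obtain ⟨I, e, m, _, _, hem⟩ := exists_image_fac (S.f ≫ p)
      have hI : ¬IsZero I := fun h => h0 (by rw [← hem, h.eq_of_src m 0, comp_zero])
      obtain ⟨X, hX, f, hf⟩ := h₁ I e inferInstance hI
      exact ⟨X, hX, f ≫ m, fun h => hf (by rwa [← cancel_mono m, zero_comp])⟩

theorem exists_hom_ne_zero {P : ObjectProperty C} {M : C} (h : (torsGen P).1 M) (hM : ¬IsZero M) :
    ∃ X, P X ∧ ∃ f : X ⟶ M, f ≠ 0 :=
  have hle : P ≤ HomGenerated P := fun X hX _ p _ hN => ⟨X, hX, p, epi_ne_zero hN⟩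
  torsGen_le_iff (T := ⟨_, isTorsionClass_homGenerated P⟩).2 hle M h M (𝟙 M) inferInstance hM

/-- Divide `M` by a subobject in `T` with torsion-free quotient `Q`. A non-zero map from `P` to `Q`
would have its image in `T`, so `Q` is zero. -/
theorem mem_of_homGenerated (hC : IsLengthCategory C) {P : ObjectProperty C} {T : Tors C}
    (hPT : P ≤ T.1) {M : C} (h : HomGenerated P M) : T.1 M := by
  obtain ⟨Q, p, _, hp, hQ⟩ := exists_quotient_torsionFree hC T.1 M
  refine prop_of_epi_of_ext p hp (prop_of_isZero_of_ext ?_)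
  by_contra hQ0
  obtain ⟨X, hX, f, hf⟩ := h Q p inferInstance hQ0
  obtain ⟨I, e, m, _, _, rfl⟩ := exists_image_fac f
  have := hQ I m inferInstance (T.1.prop_of_epi e (hPT X hX))
  exact hf (by rw [this.eq_of_src m 0, comp_zero])

theorem sSup_eq_torsGen (A : Set (Tors C)) : sSup A = torsGen fun X => ∃ U ∈ A, U.1 X :=
  le_antisymm (sSup_le fun U hU X hX => le_torsGen (fun X => ∃ U ∈ A, U.1 X) X ⟨U, hU, hX⟩)
    (torsGen_le_iff.2 fun X ⟨_, hU, hX⟩ => le_sSup hU X hX)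

theorem torsGen_eq_sSup (P : ObjectProperty C) :
    torsGen P = sSup {U | ∃ B, P B ∧ U = torsGen (ObjectProperty.singleton B)} :=
  le_antisymm (torsGen_le_iff.2 fun B hB => torsGen_singleton_le_iff.1 (le_sSup ⟨B, hB, rfl⟩))
    (sSup_le fun _ ⟨B, hB, hU⟩ => hU ▸ torsGen_singleton_le_iff.2 (le_torsGen P B hB))

end Torsion

/-! ### `WL T` is wide. -/

section WL

variable {C : Type u} [Category.{v} C] [Abelian C]

theorem WL_of_ext {T : Tors C} {S : ShortComplex C} (hS : S.ShortExact) (h₁ : WL T S.X₁)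
    (h₃ : WL T S.X₃) : WL T S.X₂ := by
  refine ⟨T.1.prop_X₂_of_shortExact hS h₁.1 h₃.1, fun X f hX => ?_⟩
  have hK := h₃.2 X (f ≫ S.g) hX
  have := hS.mono_f
  let k : kernel (f ≫ S.g) ⟶ S.X₁ := hS.exact.lift (kernel.ι (f ≫ S.g) ≫ f) (by simp)
  have hk : k ≫ S.f = kernel.ι (f ≫ S.g) ≫ f := hS.exact.lift_f _ _
  refine prop_of_iso_of_ext ?_ (h₁.2 _ k hK)
  -- `f` and `k` have the same kernel, because `kernel f` lies inside `kernel (f ≫ S.g)`.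
  refine (kernelCompMono k S.f).symm ≪≫ kernelIsoOfEq hk ≪≫ kernelKernelIso _ _ ≪≫ ?_
  have h0 : kernel.ι f ≫ f ≫ S.g = 0 := by simp
  exact kernelIsoOfEq h0 ≪≫ kernelZeroIsoSource

theorem WL_of_isZero (T : Tors C) {M : C} (hM : IsZero M) : WL T M :=
  ⟨prop_of_isZero_of_ext hM, fun X f hX => by
    obtain rfl : f = 0 := hM.eq_of_tgt _ _
    exact prop_of_iso_of_ext kernelZeroIsoSource.symm hX⟩

theorem WL_kernel {T : Tors C} {X Y : C} (f : X ⟶ Y) (hX : WL T X) (hY : WL T Y) :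
    WL T (kernel f) :=
  ⟨hY.2 X f hX.1, fun Z g hZ =>
    prop_of_iso_of_ext (kernelCompMono g (kernel.ι f)) (hX.2 Z (g ≫ kernel.ι f) hZ)⟩

/-- Pull `g` back along `cokernel.π k`. The pullback is an extension of `X` by the image of `k`,
hence in `T`, and its map to `M` has the same kernel as `g`. Only `K` in `T` is needed. -/
theorem WL_cokernel {T : Tors C} {K M : C} (k : K ⟶ M) (hK : T.1 K) (hM : WL T M) :
    WL T (cokernel k) := by
  refine ⟨T.1.prop_of_epi (cokernel.π k) hM.1, fun X g hX => ?_⟩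
  refine prop_of_iso_of_ext (kernelPullbackSndIso g (cokernel.π k)) (hM.2 _ _ ?_)
  refine prop_of_epi_of_ext (pullback.fst g (cokernel.π k)) ?_ hX
  refine prop_of_iso_of_ext (kernelPullbackFstIso g (cokernel.π k)).symm ?_
  exact T.1.prop_of_epi (Abelian.factorThruImage k) hK

theorem WL_of_iso {T : Tors C} {X Y : C} (e : X ≅ Y) (hX : WL T X) : WL T Y :=
  ⟨prop_of_iso_of_ext e hX.1, fun Z f hZ =>
    prop_of_iso_of_ext (kernelCompMono f e.inv) (hX.2 Z (f ≫ e.inv) hZ)⟩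

instance (T : Tors C) : (WL T).ContainsZero where
  exists_zero := ⟨_, isZero_zero C, WL_of_isZero T (isZero_zero C)⟩

instance (T : Tors C) : (WL T).IsClosedUnderExtensions where
  prop_X₂_of_shortExact hS h₁ h₃ := WL_of_ext hS h₁ h₃

theorem isWide_WL (T : Tors C) : IsWide (WL T) where
  exists_zero := ObjectProperty.ContainsZero.exists_zero
  kernels_le := by
    rintro _ ⟨f, k, hk, hf⟩
    exact WL_of_iso ((kernelIsKernel f).conePointUniqueUpToIso hk) (WL_kernel f hf.1 hf.2)
  cokernels_le := by
    rintro _ ⟨f, k, hk, hf⟩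
    exact WL_of_iso ((cokernelIsCokernel f).coconePointUniqueUpToIso hk)
      (WL_cokernel f hf.1.1 hf.2)
  prop_X₂_of_shortExact hS h₁ h₃ := WL_of_ext hS h₁ h₃

end WL

/-! ### Semibricks and the torsion classes they generate. -/

section Semibrick

variable {C : Type u} [Category.{v} C] [Abelian C]

theorem IsBrick.not_isZero {B : C} (h : IsBrick B) : ¬IsZero B := fun hB =>
  have := h.1
  one_ne_zero (α := End B) (hB.eq_of_src _ _)

theorem IsBrick.isIso {B : C} (h : IsBrick B) {f : B ⟶ B} (hf : f ≠ 0) : IsIso f :=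
  (isUnit_iff_isIso f).1 (h.2 f hf)

theorem isBrick_of_isIso {B : C} (hB : ¬IsZero B) (h : ∀ f : B ⟶ B, f ≠ 0 → IsIso f) :
    IsBrick B :=
  ⟨⟨𝟙 B, 0, fun h0 => hB ((IsZero.iff_id_eq_zero B).2 h0)⟩, fun f hf =>
    (isUnit_iff_isIso f).2 (h f hf)⟩

theorem IsBrick.of_iso {B B' : C} (e : B ≅ B') (h : IsBrick B) : IsBrick B' := by
  refine isBrick_of_isIso (fun h' => h.not_isZero (h'.of_iso e)) fun f hf => ?_
  have h1 : IsIso (e.hom ≫ f ≫ e.inv) := h.isIso fun h0 => hf (by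
    rwa [← cancel_mono e.inv, ← cancel_epi e.hom, zero_comp, comp_zero])
  have : f = e.inv ≫ (e.hom ≫ f ≫ e.inv) ≫ e.hom := by simp
  rw [this]
  infer_instance

theorem IsSemibrick.isIso {S : ObjectProperty C} (hS : IsSemibrick S) {B B' : C} (hB : S B)
    (hB' : S B') {f : B ⟶ B'} (hf : f ≠ 0) : IsIso f := by
  by_cases h : Nonempty (B ≅ B')
  · obtain ⟨e⟩ := h
    have : IsIso (f ≫ e.inv) := (hS.isBrick B hB).isIso fun h0 => hf (by
      rwa [← cancel_mono e.inv, zero_comp])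
    exact IsIso.of_isIso_comp_right f e.inv
  · exact absurd (hS.hom_eq_zero B B' hB hB' h f) hf

theorem isSemibrick_isoClass {B : C} (hB : IsBrick B) :
    IsSemibrick (ObjectProperty.singleton B).isoClosure where
  of_iso e h := (ObjectProperty.singleton B).isoClosure.prop_of_iso e h
  isBrick := by
    rintro X ⟨Y, hY, ⟨e⟩⟩
    obtain rfl : B = Y := by simpa using hY
    exact hB.of_iso e.symm
  hom_eq_zero := by
    rintro X X' ⟨Y, hY, ⟨e⟩⟩ ⟨Y', hY', ⟨e'⟩⟩ h
    obtain rfl : B = Y := by simpa using hY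
    obtain rfl : B = Y' := by simpa using hY'
    exact absurd ⟨e ≪≫ e'.symm⟩ h

theorem torsGen_isoClass (B : C) :
    torsGen (ObjectProperty.singleton B).isoClosure = torsGen (ObjectProperty.singleton B) := by
  refine le_antisymm (torsGen_le_iff.2 ?_) (torsGen_mono (ObjectProperty.le_isoClosure _))
  rintro X ⟨Y, hY, ⟨e⟩⟩
  exact prop_of_iso_of_ext e.symm (le_torsGen _ Y hY)

/-- The image of `f` is in `torsGen S`, so it receives a non-zero map from some brick of `S`; the
composite into `B` is an isomorphism, so the image is all of `B`. -/
theorem IsSemibrick.epi {S : ObjectProperty C} (hS : IsSemibrick S) {X B : C} (hB : S B)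
    (hX : (torsGen S).1 X) {f : X ⟶ B} (hf : f ≠ 0) : Epi f := by
  obtain ⟨I, e, m, _, _, rfl⟩ := exists_image_fac f
  have hI : ¬IsZero I := fun h => hf (by rw [h.eq_of_src m 0, comp_zero])
  obtain ⟨B', hB', g, hg⟩ := exists_hom_ne_zero ((torsGen S).1.prop_of_epi e hX) hI
  have : IsIso (g ≫ m) := hS.isIso hB' hB fun h => hg (by rwa [← cancel_mono m, zero_comp])
  have : Epi m := epi_of_epi g m
  exact epi_comp e m

/-- The pushout of a short exact sequence along an epimorphism. -/
theorem exists_pushout_shortExact {X Y : C} (f : X ⟶ Y) [Epi f] {N : C} (q : kernel f ⟶ N)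
    [Epi q] : ∃ S : ShortComplex C, S.ShortExact ∧ Nonempty (S.X₁ ≅ N) ∧ Nonempty (S.X₃ ≅ Y) ∧
      ∃ t : X ⟶ S.X₂, Epi t :=
  ⟨_, shortExact_cokernel_comp (kernel.ι q) (kernel.ι f), ⟨cokernelIso (shortExact_of_epi q)⟩,
    ⟨cokernelIso (shortExact_of_epi f)⟩, cokernel.π _, inferInstance⟩

/-- For a non-zero quotient `N` of `kernel f`, the pushout gives an extension `E` of `B` by `N` with
middle term in `torsGen S`. A non-zero map from a brick to it either factors through `N` or splits
`E`, and then `N` is itself a quotient of the middle term. -/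
theorem IsSemibrick.kernel_mem (hC : IsLengthCategory C) {S : ObjectProperty C}
    (hS : IsSemibrick S) {X B : C} (hB : S B) (hX : (torsGen S).1 X) (f : X ⟶ B) :
    (torsGen S).1 (kernel f) := by
  by_cases hf : f = 0
  · subst hf
    exact prop_of_iso_of_ext kernelZeroIsoSource.symm hX
  have := hS.epi hB hX hf
  refine mem_of_homGenerated hC (le_torsGen S) fun N q _ hN => ?_
  obtain ⟨E, hE, ⟨e₁⟩, ⟨e₃⟩, t, _⟩ := exists_pushout_shortExact f q
  have := hE.mono_f
  have hE₂ : (torsGen S).1 E.X₂ := (torsGen S).1.prop_of_epi t hX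
  obtain ⟨B', hB', g, hg⟩ :=
    exists_hom_ne_zero hE₂ fun h => hN ((h.of_mono E.f).of_iso e₁.symm)
  by_cases hgE : g ≫ E.g = 0
  · refine ⟨B', hB', hE.exact.lift g hgE ≫ e₁.hom, fun h => hg ?_⟩
    rw [← hE.exact.lift_f g hgE, (cancel_mono e₁.hom).1 (h.trans zero_comp.symm), zero_comp]
  · have : IsIso (g ≫ E.g ≫ e₃.hom) := hS.isIso hB' hB fun h => hgE (by
      rwa [← Category.assoc, ← zero_comp (f := e₃.hom), cancel_mono] at h)
    have hsec : (e₃.hom ≫ inv (g ≫ E.g ≫ e₃.hom) ≫ g) ≫ E.g = 𝟙 _ := by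
      rw [← cancel_mono e₃.hom]
      simp
    have s := ShortComplex.Splitting.ofExactOfSection E hE.exact _ hsec hE.mono_f
    have : Epi s.r := (SplitEpi.mk E.f s.f_r).epi
    exact exists_hom_ne_zero ((torsGen S).1.prop_of_epi (s.r ≫ e₁.hom) hE₂) hN

theorem IsSemibrick.le_WL (hC : IsLengthCategory C) {S : ObjectProperty C} (hS : IsSemibrick S) :
    S ≤ WL (torsGen S) :=
  fun B hB => ⟨le_torsGen S B hB, fun _ f hX => hS.kernel_mem hC hB hX f⟩

/-- Divide `M` by a subobject in `Filt S` so that the quotient `Q` has no non-zero one. A non-zero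
`g : B ⟶ Q` has its kernel in `torsGen S`, since `Q` is still in `WL`; the inclusion of that kernel
in `B` is then zero or epi. Epi would kill `g`, so `g` embeds `B` in `Q`, a contradiction. -/
theorem IsSemibrick.WL_torsGen (hC : IsLengthCategory C) {S : ObjectProperty C}
    (hS : IsSemibrick S) : WL (torsGen S) = Filt S := by
  refine le_antisymm (fun M hM => ?_) (filt_le (hS.le_WL hC))
  obtain ⟨Q, p, _, hp, hQ⟩ := exists_quotient_torsionFree hC (Filt S) M
  refine prop_of_epi_of_ext p hp (prop_of_isZero_of_ext ?_)
  by_contra hQ0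
  have hWQ : WL (torsGen S) Q := WL_of_iso (cokernelIso (shortExact_of_epi p))
    (WL_cokernel (kernel.ι p) (filt_le (hS.le_WL hC) _ hp).1 hM)
  obtain ⟨B, hB, g, hg⟩ := exists_hom_ne_zero hWQ.1 hQ0
  have hK := hWQ.2 B g (le_torsGen S B hB)
  have hι : kernel.ι g = 0 := by
    by_contra h
    have := hS.epi hB hK h
    exact hg ((cancel_epi (kernel.ι g)).1 (by simp))
  have : Mono g := Preadditive.mono_of_kernel_zero hι
  exact (hS.isBrick B hB).not_isZero (hQ B g inferInstance (le_filt S B hB))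

theorem IsSemibrick.isWide_filt (hC : IsLengthCategory C) {S : ObjectProperty C}
    (hS : IsSemibrick S) : IsWide (Filt S) :=
  hS.WL_torsGen hC ▸ isWide_WL (torsGen S)

end Semibrick

/-! ### Wide subcategories and their simple objects. -/

section Wide

variable {C : Type u} [Category.{v} C] [Abelian C]

theorem IsWide.kernel {W : ObjectProperty C} (hW : IsWide W) {X Y : C} (f : X ⟶ Y) (hX : W X)
    (hY : W Y) : W (kernel f) :=
  have := hW.toIsClosedUnderKernels
  W.prop_kernel f hX hY

theorem IsWide.cokernel {W : ObjectProperty C} (hW : IsWide W) {X Y : C} (f : X ⟶ Y) (hX : W X)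
    (hY : W Y) : W (cokernel f) :=
  have := hW.toIsClosedUnderCokernels
  W.prop_cokernel f hX hY

/-- Monomorphisms in `W` are monomorphisms in `C` because kernels stay in `W`, so simplicity can be
tested in `C` on subobjects from `W`. -/
theorem simp_iff {W : ObjectProperty C} (hW : IsWide W) {X : C} :
    TorsWide.simp W X ↔ W X ∧ ¬IsZero X ∧
      ∀ (Y : C) (f : Y ⟶ X), W Y → Mono f → ¬IsZero Y → IsIso f := by
  constructor
  · rintro ⟨hX, h⟩
    refine ⟨hX, fun h0 => ?_, fun Y f hY _ hY0 => ?_⟩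
    · have := (h.mono_isIso_iff_nonzero (𝟙 _)).1 inferInstance
      exact this (by ext; exact h0.eq_of_src _ _)
    · let f' : (⟨Y, hY⟩ : W.FullSubcategory) ⟶ ⟨X, hX⟩ := ObjectProperty.homMk f
      have : Mono f' := W.ι.mono_of_mono_map (inferInstanceAs (Mono f))
      have hf' : f' ≠ 0 := fun h => mono_ne_zero (f := f) hY0 (congrArg W.ι.map h)
      have := (h.mono_isIso_iff_nonzero f').2 hf'
      exact inferInstanceAs (IsIso (W.ι.map f'))
  · rintro ⟨hX, hX0, h⟩
    refine ⟨hX, ⟨fun {Y} f _ => ⟨fun _ h0 => hX0 ?_, fun hf => ?_⟩⟩⟩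
    · have : IsIso (W.ι.map f) := inferInstance
      have h0' : W.ι.map f = (0 : Y.obj ⟶ X) := congrArg W.ι.map h0
      rw [h0'] at this
      have : Epi (0 : Y.obj ⟶ X) := IsIso.epi_of_iso _
      exact IsZero.of_epi_zero Y.obj X
    · have hf' : f.hom ≠ 0 := fun h => hf (by ext; exact h)
      have hK := hW.kernel f.hom Y.property hX
      have hι : kernel.ι f.hom = 0 := by
        let k : (⟨_, hK⟩ : W.FullSubcategory) ⟶ Y := ObjectProperty.homMk (kernel.ι f.hom)
        have : k = 0 := by
          rw [← cancel_mono f]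
          ext
          simp [k]
        exact congrArg W.ι.map this
      have : Mono f.hom := Preadditive.mono_of_kernel_zero hι
      have : IsIso (W.ι.map f) := h Y.obj f.hom Y.property this (not_isZero_of_ne_zero hf')
      exact isIso_of_reflects_iso f W.ι

/-- Schur's lemma in `W`. -/
theorem isIso_of_simp {W : ObjectProperty C} (hW : IsWide W) {X Y : C} (hX : TorsWide.simp W X)
    (hY : TorsWide.simp W Y) {f : X ⟶ Y} (hf : f ≠ 0) : IsIso f := by
  rw [simp_iff hW] at hX hY
  have hK := hW.kernel f hX.1 hY.1
  have h0 : kernel.ι f = 0 := by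
    by_contra h
    have := hX.2.2 _ (kernel.ι f) hK inferInstance (not_isZero_of_ne_zero h)
    exact hf ((cancel_epi (kernel.ι f)).1 (by simp))
  have : Mono f := Preadditive.mono_of_kernel_zero h0
  exact hY.2.2 X f hX.1 inferInstance hX.2.1

theorem isSemibrick_simp {W : ObjectProperty C} (hW : IsWide W) :
    IsSemibrick (TorsWide.simp W) where
  of_iso {X Y} e hX := by
    have := hW.toContainsZero
    have := hW.toIsClosedUnderExtensions
    rw [simp_iff hW] at hX ⊢
    refine ⟨prop_of_iso_of_ext e hX.1, fun h => hX.2.1 (h.of_iso e), fun Z f hZ _ hZ0 => ?_⟩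
    have := hX.2.2 Z (f ≫ e.inv) hZ inferInstance hZ0
    exact IsIso.of_isIso_comp_right f e.inv
  isBrick B hB := isBrick_of_isIso ((simp_iff hW).1 hB).2.1 fun _ hf => isIso_of_simp hW hB hB hf
  hom_eq_zero B₁ B₂ h₁ h₂ h f := by
    by_contra hf
    have := isIso_of_simp hW h₁ h₂ hf
    exact h ⟨asIso f⟩

/-- If the quotient of `M` by a maximal `Filt (simp W)` part were non-zero, it would lie in `W`, and
a minimal non-zero `W`-subobject of it would be simple in `W`. -/
theorem filt_simp (hC : IsLengthCategory C) {W : ObjectProperty C} (hW : IsWide W) :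
    Filt (TorsWide.simp W) = W := by
  have := hW.toContainsZero
  have := hW.toIsClosedUnderExtensions
  have hle : Filt (TorsWide.simp W) ≤ W := filt_le fun X hX => hX.1
  refine le_antisymm hle fun M hM => ?_
  obtain ⟨Q, p, _, hp, hQ⟩ := exists_quotient_torsionFree hC (Filt (TorsWide.simp W)) M
  refine prop_of_epi_of_ext p hp (prop_of_isZero_of_ext ?_)
  by_contra hQ0
  have hWQ : W Q := prop_of_iso_of_ext (cokernelIso (shortExact_of_epi p))
    (hW.cokernel (kernel.ι p) (hle _ hp) hM)
  obtain ⟨Y, i, _, hY, hY0, hmin⟩ := exists_minimal_subobject hC W hQ0 hWQ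
  exact hY0 (hQ Y i inferInstance (le_filt _ _ ((simp_iff hW).2
    ⟨hY, hY0, fun Z f hZ _ hZ0 => hmin Z f inferInstance hZ hZ0⟩)))

/-- Bricks of `S` are simple by `IsSemibrick.epi`; any other simple object receives a non-zero map
from one of them, and Schur's lemma applies. -/
theorem IsSemibrick.simp_filt (hC : IsLengthCategory C) {S : ObjectProperty C}
    (hS : IsSemibrick S) : TorsWide.simp (Filt S) = S := by
  have hW := hS.isWide_filt hC
  have hle : S ≤ TorsWide.simp (Filt S) := fun B hB => by
    refine (simp_iff hW).2 ⟨le_filt S B hB, (hS.isBrick B hB).not_isZero, fun Y f hY _ hY0 => ?_⟩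
    have := hS.epi hB (filt_le (le_torsGen S) Y hY) (mono_ne_zero (f := f) hY0)
    exact isIso_of_mono_of_epi f
  refine le_antisymm (fun M hM => ?_) hle
  obtain ⟨B, hB, f, hf⟩ := exists_hom_ne_zero (filt_le (le_torsGen S) M hM.1)
    ((simp_iff hW).1 hM).2.1
  have := isIso_of_simp hW (hle B hB) hM hf
  exact hS.of_iso (asIso f) hB

end Wide

/-! ### Canonical join representations and bricks. -/

section CJR

variable {C : Type u} [Category.{v} C] [Abelian C]

/-- A brick is determined up to isomorphism by the torsion class that it generates. -/
theorem IsBrick.nonempty_iso {B B' : C} (hB : IsBrick B) (hB' : IsBrick B')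
    (h : torsGen (ObjectProperty.singleton B) = torsGen (ObjectProperty.singleton B')) :
    Nonempty (B ≅ B') := by
  have key : ∀ {B B' : C}, IsBrick B → IsBrick B' →
      torsGen (ObjectProperty.singleton B) = torsGen (ObjectProperty.singleton B') →
      ∃ f : B ⟶ B', Epi f := by
    intro B B' hB hB' h
    have hmem : (torsGen (ObjectProperty.singleton B)).1 B' := h ▸ mem_torsGen_singleton B'
    obtain ⟨X, hX, f, hf⟩ := exists_hom_ne_zero hmem hB'.not_isZero
    obtain rfl : B = X := by simpa using hX
    -- The isomorphism class of `B'` is itself a semibrick, generating the same torsion class as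
    -- `B`.
    refine ⟨f, (isSemibrick_isoClass hB').epi (ObjectProperty.le_isoClosure _ _ (by simp)) ?_ hf⟩
    rw [torsGen_isoClass, ← h]
    exact mem_torsGen_singleton B
  obtain ⟨f, _⟩ := key hB hB' h
  obtain ⟨g, _⟩ := key hB' hB h.symm
  have : IsIso (f ≫ g) := hB.isIso (epi_ne_zero hB.not_isZero)
  have : Mono f := mono_of_mono f g
  have := isIso_of_mono_of_epi f
  exact ⟨asIso f⟩

theorem IsSemibrick.isCanonicalJoinRep {S : ObjectProperty C} (hS : IsSemibrick S) :
    IsCanonicalJoinRep (torsGen S)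
      {U | ∃ B, S B ∧ U = torsGen (ObjectProperty.singleton B)} where
  sSup_eq := torsGen_eq_sSup S
  refines := by
    rintro A hA _ ⟨B, hB, rfl⟩
    have hmem : (sSup A).1 B := hA ▸ le_torsGen S B hB
    rw [sSup_eq_torsGen] at hmem
    obtain ⟨Y, ⟨U, hU, hY⟩, f, hf⟩ := exists_hom_ne_zero hmem (hS.isBrick B hB).not_isZero
    have hYS : (torsGen S).1 Y := by
      rw [hA]
      exact le_sSup hU Y hY
    have := hS.epi hB hYS hf
    exact ⟨U, hU, torsGen_singleton_le_iff.2 (U.1.prop_of_epi f hY)⟩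
  antichain := by
    rintro _ ⟨B, hB, rfl⟩ _ ⟨B', hB', rfl⟩ h
    obtain ⟨X, hX, f, hf⟩ := exists_hom_ne_zero (torsGen_singleton_le_iff.1 h)
      (hS.isBrick B hB).not_isZero
    obtain rfl : B' = X := by simpa using hX
    have := hS.isIso hB' hB hf
    exact torsGen_singleton_congr (asIso f).symm

theorem IsSemibrick.brickCJR_torsGen {S : ObjectProperty C} (hS : IsSemibrick S) :
    brickCJR (torsGen S) = S := by
  ext B
  rw [brickCJR, hS.isCanonicalJoinRep.cjr_eq]
  constructor
  · rintro ⟨hB, B', hB', h⟩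
    obtain ⟨e⟩ := hB.nonempty_iso (hS.isBrick B' hB') h
    exact hS.of_iso e.symm hB'
  · exact fun hB => ⟨hS.isBrick B hB, B, hB, rfl⟩

/-- Every torsion class is generated by its bricks. -/
theorem torsGen_bricks (hC : IsLengthCategory C) (U : Tors C) :
    torsGen (fun B => IsBrick B ∧ U.1 B) = U := by
  refine le_antisymm (torsGen_le_iff.2 fun B hB => hB.2) fun M hM => ?_
  refine mem_of_homGenerated hC (le_torsGen _) fun N p _ hN => ?_
  -- A minimal non-zero subobject in `U` is a brick: the image of a non-zero endomorphism is again
  -- in `U`, hence everything.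
  obtain ⟨Y, i, _, hY, hY0, hmin⟩ :=
    exists_minimal_subobject hC U.1 hN (U.1.prop_of_epi p hM)
  refine ⟨Y, ⟨isBrick_of_isIso hY0 fun f hf => ?_, hY⟩, i, mono_ne_zero hY0⟩
  obtain ⟨I, e, m, _, _, rfl⟩ := exists_image_fac f
  have := hmin I m inferInstance (U.1.prop_of_epi e hY)
    fun h => hf (by rw [h.eq_of_src m 0, comp_zero])
  have : Epi (e ≫ m) := epi_comp e m
  exact isIso_of_epi_endo hC (e ≫ m)

/-- An element of a canonical join representation lies below some member of every family which
can replace it. -/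
theorem IsCanonicalJoinRep.exists_le_of_le_sSup {L : Type*} [CompleteLattice L] {x : L}
    {A : Set L} (hA : IsCanonicalJoinRep x A) {a : L} (ha : a ∈ A) {D : Set L}
    (hD : ∀ d ∈ D, d ≤ x) (h : a ≤ sSup ((A \ {a}) ∪ D)) : ∃ d ∈ D, a ≤ d := by
  have hx : x = sSup ((A \ {a}) ∪ D) := by
    apply le_antisymm
    · rw [hA.sSup_eq]
      refine sSup_le fun b hb => ?_
      by_cases hba : b = a
      · exact hba ▸ h
      · exact le_sSup (Or.inl ⟨hb, hba⟩)
    · refine sSup_le ?_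
      rintro b (hb | hb)
      · rw [hA.sSup_eq]
        exact le_sSup hb.1
      · exact hD b hb
  obtain ⟨b, hb | hb, hab⟩ := hA.refines _ hx a ha
  · exact absurd (hA.antichain a ha b hb.1 hab).symm hb.2
  · exact ⟨b, hb, hab⟩

/-- Replace `U` in `A` by the classes generated by its bricks; the join is unchanged, so `U` lies
below one of them. -/
theorem IsCanonicalJoinRep.exists_brick (hC : IsLengthCategory C) {T : Tors C} {A : Set (Tors C)}
    (hA : IsCanonicalJoinRep T A) {U : Tors C} (hU : U ∈ A) :
    ∃ B, IsBrick B ∧ U = torsGen (ObjectProperty.singleton B) := by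
  have hUT : U ≤ T := hA.sSup_eq ▸ le_sSup hU
  have hsup := torsGen_eq_sSup fun B => IsBrick B ∧ U.1 B
  rw [torsGen_bricks hC U] at hsup
  obtain ⟨V, ⟨B, ⟨hB, hBU⟩, rfl⟩, hle⟩ := hA.exists_le_of_le_sSup hU
    (D := {V | ∃ B, (IsBrick B ∧ U.1 B) ∧ V = torsGen (ObjectProperty.singleton B)})
    (by rintro _ ⟨B, hB, rfl⟩; exact (torsGen_singleton_le_iff.2 hB.2).trans hUT)
    (hsup.le.trans (sSup_le_sSup Set.subset_union_right))
  exact ⟨B, hB, le_antisymm hle (torsGen_singleton_le_iff.2 hBU)⟩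

theorem IsCanonicalJoinRep.torsGen_brickCJR (hC : IsLengthCategory C) {T : Tors C}
    {A : Set (Tors C)} (hA : IsCanonicalJoinRep T A) : torsGen (brickCJR T) = T := by
  have h : {U | ∃ B, brickCJR T B ∧ U = torsGen (ObjectProperty.singleton B)} = A := by
    ext U
    constructor
    · rintro ⟨B, hB, rfl⟩
      exact hA.cjr_eq ▸ hB.2
    · intro hU
      obtain ⟨B, hB, rfl⟩ := hA.exists_brick hC hU
      exact ⟨B, ⟨hB, hA.cjr_eq.symm ▸ hU⟩, rfl⟩
  rw [torsGen_eq_sSup, h, hA.sSup_eq]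

theorem IsCanonicalJoinRep.isSemibrick_brickCJR {T : Tors C}
    {A : Set (Tors C)} (hA : IsCanonicalJoinRep T A) : IsSemibrick (brickCJR T) where
  of_iso e h := ⟨h.1.of_iso e, torsGen_singleton_congr e ▸ h.2⟩
  isBrick _ h := h.1
  hom_eq_zero B₁ B₂ h₁ h₂ hne f := by
    by_contra hf
    have hA₁ := hA.cjr_eq ▸ h₁.2
    have hA₂ := hA.cjr_eq ▸ h₂.2
    have hBT : T.1 B₂ := torsGen_singleton_le_iff.1 (hA.sSup_eq ▸ le_sSup hA₂)
    obtain ⟨I, e, m, _, _, rfl⟩ := exists_image_fac f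
    have hm : m ≠ 0 := fun h => hf (by rw [h, comp_zero])
    -- Replace the class of `B₂` by that of `cokernel m`. The class of `B₁` is distinct and remains,
    -- and `B₂` is an extension of `cokernel m` by a quotient of `B₁`, so the join still contains
    -- `B₂`.
    obtain ⟨_, rfl, hle⟩ := hA.exists_le_of_le_sSup hA₂
      (D := {torsGen (ObjectProperty.singleton (cokernel m))})
      (by
        rintro _ rfl
        exact torsGen_singleton_le_iff.2 (T.1.prop_of_epi (cokernel.π m) hBT))
      (by
        set V := sSup ((A \ {torsGen (ObjectProperty.singleton B₂)}) ∪
          {torsGen (ObjectProperty.singleton (cokernel m))})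
        have hV₁ : V.1 B₁ := torsGen_singleton_le_iff.1 (le_sSup (Or.inl ⟨hA₁, fun h =>
          hne (h₁.1.nonempty_iso h₂.1 h)⟩))
        have hV₂ : V.1 (cokernel m) := torsGen_singleton_le_iff.1 (le_sSup (Or.inr rfl))
        exact torsGen_singleton_le_iff.2 (V.1.prop_X₂_of_shortExact (shortExact_of_mono m)
          (V.1.prop_of_epi e hV₁) hV₂))
    obtain ⟨X, hX, g, hg⟩ :=
      exists_hom_ne_zero (torsGen_singleton_le_iff.1 hle) h₂.1.not_isZero
    obtain rfl : cokernel m = X := by simpa using hX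
    -- A non-zero map from `cokernel m` back to `B₂` yields a non-zero, hence invertible,
    -- endomorphism of `B₂`, forcing `m = 0`.
    have : IsIso (cokernel.π m ≫ g) := h₂.1.isIso fun h =>
      hg ((cancel_epi (cokernel.π m)).1 (by rw [h, comp_zero]))
    have : Mono (cokernel.π m) := mono_of_mono _ g
    exact hm ((cancel_mono (cokernel.π m)).1 (by simp))

end CJR

end TorsWide

theorem theorem4 {C : Type u} [Category.{v} C] [Abelian C] (hC : IsLengthCategory C) :
    -- (1) widely generated torsion classes
    (∀ T : Tors C, IsWidelyGenerated T ↔ ∃ A : Set (Tors C), IsCanonicalJoinRep T A) ∧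
    -- (2) wide subcategories
    (Set.BijOn torsGen (wide C) (canonicalElements (Tors C)) ∧
      Set.BijOn WL (canonicalElements (Tors C)) (wide C) ∧
      Set.InvOn WL torsGen (wide C) (canonicalElements (Tors C))) ∧
    -- (3) semibricks
    ((∀ T ∈ canonicalElements (Tors C), IsSemibrick (brickCJR T)) ∧
      Set.BijOn torsGen (sbrick C) (canonicalElements (Tors C)) ∧
      Set.BijOn brickCJR (canonicalElements (Tors C)) (sbrick C) ∧
      Set.InvOn brickCJR torsGen (sbrick C) (canonicalElements (Tors C))) ∧
    -- (4) the commutative square of bijections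
    (Set.BijOn Filt (sbrick C) (wide C) ∧
      Set.BijOn TorsWide.simp (wide C) (sbrick C) ∧
      Set.InvOn TorsWide.simp Filt (sbrick C) (wide C) ∧
      (∀ S ∈ sbrick C, torsGen (Filt S) = torsGen S) ∧
      (∀ W ∈ wide C, torsGen (TorsWide.simp W) = torsGen W) ∧
      (∀ T ∈ canonicalElements (Tors C), Filt (brickCJR T) = WL T) ∧
      (∀ T ∈ canonicalElements (Tors C), TorsWide.simp (WL T) = brickCJR T)) := by
  have hsb : ∀ T ∈ canonicalElements (Tors C), IsSemibrick (brickCJR T) :=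
    fun T ⟨_, hA⟩ => hA.isSemibrick_brickCJR
  have hgen : ∀ T ∈ canonicalElements (Tors C), torsGen (brickCJR T) = T :=
    fun T ⟨_, hA⟩ => hA.torsGen_brickCJR hC
  have hsimp : ∀ W ∈ wide C, torsGen (TorsWide.simp W) = torsGen W := fun W hW => by
    rw [← torsGen_filt, filt_simp hC hW]
  have hWL : ∀ T ∈ canonicalElements (Tors C), Filt (brickCJR T) = WL T := fun T hT => by
    rw [← (hsb T hT).WL_torsGen hC, hgen T hT]
  have hcan : ∀ S ∈ sbrick C, torsGen S ∈ canonicalElements (Tors C) :=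
    fun S hS => ⟨_, IsSemibrick.isCanonicalJoinRep hS⟩
  have hcanW : ∀ W ∈ wide C, torsGen W ∈ canonicalElements (Tors C) := fun W hW =>
    hsimp W hW ▸ hcan _ (isSemibrick_simp hW)
  -- Both composites are computed on semibricks: `simp W` for a wide `W`, and `brickCJR T` for `T`.
  have inv₂ : Set.InvOn WL torsGen (wide C) (canonicalElements (Tors C)) :=
    ⟨fun W hW => by rw [← hsimp W hW, (isSemibrick_simp hW).WL_torsGen hC, filt_simp hC hW],
      fun T hT => by rw [← hWL T hT, torsGen_filt, hgen T hT]⟩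
  have inv₃ : Set.InvOn brickCJR torsGen (sbrick C) (canonicalElements (Tors C)) :=
    ⟨fun S hS => IsSemibrick.brickCJR_torsGen hS, hgen⟩
  have inv₄ : Set.InvOn TorsWide.simp Filt (sbrick C) (wide C) :=
    ⟨fun S hS => IsSemibrick.simp_filt hC hS, fun W hW => filt_simp hC hW⟩
  have mapsWL : Set.MapsTo WL (canonicalElements (Tors C)) (wide C) := fun T _ => isWide_WL T
  have mapsFilt : Set.MapsTo Filt (sbrick C) (wide C) := fun S hS => IsSemibrick.isWide_filt hC hS
  have mapsSimp : Set.MapsTo TorsWide.simp (wide C) (sbrick C) := fun W hW => isSemibrick_simp hW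
  refine ⟨fun T => ⟨?_, fun hT => ⟨WL T, isWide_WL T, (inv₂.2 hT).symm⟩⟩,
    ⟨inv₂.bijOn hcanW mapsWL, inv₂.symm.bijOn mapsWL hcanW, inv₂⟩,
    ⟨hsb, inv₃.bijOn hcan hsb, inv₃.symm.bijOn hsb hcan, inv₃⟩,
    inv₄.bijOn mapsFilt mapsSimp, inv₄.symm.bijOn mapsSimp mapsFilt, inv₄,
    fun S _ => torsGen_filt S, hsimp, hWL, fun T hT => ?_⟩
  · rintro ⟨W, hW, rfl⟩
    exact hcanW W hW
  · rw [← hWL T hT, (hsb T hT).simp_filt hC]
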